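/- Let $\mathcal{A}(\mathbb{R})$ be the complex vector space of all real analytic functions $f:\mathbb{R}\to\mathbb{C}$. For a real analytic map $\varphi:\mathbb{R}\to\mathbb{R}$ let $C_\varphi:\mathcal{A}(\mathbb{R})\to\mathcal{A}(\mathbb{R})$, $C_\varphi(f)=f\circ\varphi$, be the composition operator; let $\sigma_p(C_\varphi)$ be its set of eigenvalues and $\sigma(C_\varphi)$ its spectrum, i.e. the set of all $\lambda\in\mathbb{C}$ such that $C_\varphi-\lambda I$ is not bijective on $\mathcal{A}(\mathbb{R})$ (for the natural locally convex topology of $\mathcal{A}(\mathbb{R})$ this is, by the open mapping theorem, the same as not having a continuous inverse). Let $\delta:\mathbb{R}\to\mathbb{R}$ be a real analytic diffeomorphism (a bijection such that $\delta$ and $\delta^{-1}$ are real analytic) and let $s\in\mathbb{N}$, $s>1$. Then the map $\varphi:\mathbb{R}\to\mathbb{R}$, $\varphi(x)=\delta^{-1}(\delta(x)^s)$, is real analytic, and $$\sigma_p(C_\varphi)=\{1\},\qquad \sigma(C_\varphi)=\mathbb{C}.$$ -/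

import Mathlib

/-- The space `𝒜(ℝ)` of complex-valued real analytic functions on the real line. -/
def RealAnalyticSpace : Submodule ℂ (ℝ → ℂ) where
  carrier := {f | AnalyticOnNhd ℝ f Set.univ}
  add_mem' hf hg := hf.add hg
  zero_mem' := analyticOnNhd_const
  smul_mem' c f hf := (analyticOnNhd_const (v := c)).mul hf

/-- The composition operator `C_φ f = f ∘ φ` on `𝒜(ℝ)`, for a real analytic map `φ : ℝ → ℝ`.

Its spectrum is taken in the algebra `Module.End ℂ 𝒜(ℝ)`: it consists of the `z` for which
`C_φ - z I` is not bijective. For the usual topology of `𝒜(ℝ)` a continuous linear bijection has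
a continuous inverse (open mapping theorem), so this is the spectrum of `C_φ` as a continuous
operator; for any topology it is contained in the latter. -/
def compositionOperator (φ : ℝ → ℝ) (hφ : AnalyticOnNhd ℝ φ Set.univ) :
    Module.End ℂ RealAnalyticSpace where
  toFun f := ⟨(f : ℝ → ℂ) ∘ φ, AnalyticOnNhd.comp f.2 hφ (Set.mapsTo_univ φ Set.univ)⟩
  map_add' _ _ := rfl
  map_smul' _ _ := rfl

open Filter Topology

/-! Conjugation by `δ` reduces everything to `x ↦ x ^ s`. An eigenfunction with `z ≠ 1` vanishes at
`0`, hence is `O(x)` there, while `f (x ^ s ^ k) = z ^ k * f x`; the superexponential decay of `x ^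
s ^ k` forces `f = 0`.

For the spectrum, surjectivity fails for every `z`. If `z ≠ 0`, Euler operators turn `f (x ^ s) - z
f(x) = x ^ m` into an equation whose coefficient ratio `ν` has modulus `> 1`. Summing along the
two-sided orbit `x_i = exp (-s ^ i)` telescopes to `∑ ν ^ i * x_i ^ m = 0`, which cannot hold for
all `m ≥ 1`. -/

theorem summable_pow_mul_pow_pow {s : ℕ} (hs : 1 < s) {r x : ℝ} (hr : 0 < r) (hx0 : 0 < x)
    (hx1 : x < 1) : Summable fun k : ℕ => r ^ k * x ^ s ^ k := by
  refine summable_of_ratio_test_tendsto_lt_one (l := 0) zero_lt_one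
    (Eventually.of_forall fun k => by positivity) ?_
  have h1 : Tendsto (fun k : ℕ => s ^ k * (s - 1)) atTop atTop :=
    (tendsto_pow_atTop_atTop_of_one_lt hs).atTop_mul_const' (by omega)
  have h2 : Tendsto (fun k : ℕ => r * x ^ (s ^ k * (s - 1))) atTop (𝓝 (r * 0)) :=
    ((tendsto_pow_atTop_nhds_zero_of_lt_one hx0.le hx1).comp h1).const_mul r
  rw [mul_zero] at h2
  refine h2.congr fun k => ?_
  have e : s ^ (k + 1) = s ^ k + s ^ k * (s - 1) := by
    obtain ⟨t, rfl⟩ : ∃ t, s = t + 1 := ⟨s - 1, by omega⟩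
    simp only [Nat.add_sub_cancel]
    ring
  rw [Real.norm_of_nonneg (by positivity), Real.norm_of_nonneg (by positivity), e, pow_add,
    pow_succ, eq_div_iff (by positivity)]
  ring

/-- The exponential wins as `i → +∞`; as `i → -∞` it is at most `1` and `r ^ i` is geometric. -/
theorem summable_zpow_mul_exp_neg_zpow {s : ℕ} (hs : 1 < s) {r : ℝ} (hr : 1 < r) :
    Summable fun i : ℤ => r ^ i * Real.exp (-(s : ℝ) ^ i) := by
  have hr0 : 0 < r := zero_lt_one.trans hr
  refine Summable.of_nat_of_neg_add_one ?_ ?_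
  · have h := summable_pow_mul_pow_pow hs hr0 (Real.exp_pos (-1)) (by simp)
    refine h.congr fun k => ?_
    rw [← Real.exp_nat_mul]
    simp
  · have h : Summable fun k : ℕ => r⁻¹ ^ (k + 1) :=
      (summable_nat_add_iff 1).2 (summable_geometric_of_lt_one (by positivity)
        (inv_lt_one_of_one_lt₀ hr))
    refine h.of_nonneg_of_le (fun k => by positivity) fun k => ?_
    have e : r ^ (-((k : ℤ) + 1)) = r⁻¹ ^ (k + 1) := by
      rw [zpow_neg, inv_pow, ← zpow_natCast]
      push_cast
      rfl
    rw [e]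
    refine mul_le_of_le_one_right (by positivity) (Real.exp_le_one_iff.2 ?_)
    exact neg_nonpos.2 (by positivity)

theorem AnalyticOnNhd.exists_norm_le_mul {f : ℝ → ℂ} (hf : AnalyticOnNhd ℝ f Set.univ)
    (h0 : f 0 = 0) : ∃ C : ℝ, ∀ x ∈ Set.Icc (0 : ℝ) 1, ‖f x‖ ≤ C * x := by
  have hc : Continuous (deriv f) := continuousOn_univ.1 hf.deriv.continuousOn
  obtain ⟨C, hC⟩ := (isCompact_Icc (a := (0 : ℝ)) (b := 1)).exists_bound_of_continuousOn
    hc.continuousOn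
  refine ⟨C, fun x hx => ?_⟩
  have h := (convex_Icc (0 : ℝ) 1).norm_image_sub_le_of_norm_deriv_le
    (fun y _ => (hf y trivial).differentiableAt) hC (Set.left_mem_Icc.2 zero_le_one) hx
  simpa [h0, abs_of_nonneg hx.1] using h

/-- A real analytic solution of `f (x ^ s) = z f(x)` that vanishes at `0` is zero. -/
theorem eq_zero_of_comp_pow_eq_mul {s : ℕ} (hs : 1 < s) {f : ℝ → ℂ}
    (hf : AnalyticOnNhd ℝ f Set.univ) (h0 : f 0 = 0) {z : ℂ}
    (h : ∀ x, f (x ^ s) = z * f x) : f = 0 := by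
  have key : ∀ x ∈ Set.Ioo (0 : ℝ) 1, f x = 0 := by
    intro x hx
    rcases eq_or_ne z 0 with rfl | hz
    -- For `z = 0`, every `x` in the interval is an `s`-th power.
    · have := h (x ^ (s : ℝ)⁻¹)
      rwa [zero_mul, Real.rpow_inv_natCast_pow hx.1.le (by omega)] at this
    obtain ⟨C, hC⟩ := hf.exists_norm_le_mul h0
    have hit : ∀ k : ℕ, f (x ^ s ^ k) = z ^ k * f x := by
      intro k
      induction k with
      | zero => simp
      | succ k ih => rw [pow_succ, pow_mul, h, ih, pow_succ]; ring
    have ht : Tendsto (fun k : ℕ => C * (‖z‖⁻¹ ^ k * x ^ s ^ k)) atTop (𝓝 (C * 0)) :=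
      (summable_pow_mul_pow_pow hs (inv_pos.2 (norm_pos_iff.2 hz)) hx.1
        hx.2).tendsto_atTop_zero.const_mul C
    rw [mul_zero] at ht
    refine norm_le_zero_iff.1 (ge_of_tendsto' ht fun k => ?_)
    have hb := hC (x ^ s ^ k) ⟨pow_nonneg hx.1.le _, pow_le_one₀ hx.1.le hx.2.le⟩
    rw [hit, norm_mul, norm_pow] at hb
    have hzk : 0 < ‖z‖ ^ k := pow_pos (norm_pos_iff.2 hz) k
    rw [inv_pow, mul_left_comm, inv_mul_eq_div, le_div_iff₀ hzk]
    linarith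
  refine hf.eq_of_eventuallyEq (g := 0) analyticOnNhd_const (z₀ := 1 / 2) ?_
  filter_upwards [Ioo_mem_nhds (show (0 : ℝ) < 1 / 2 by norm_num) (show (1 / 2 : ℝ) < 1 by norm_num)] with x hx
  exact key x hx

/-- The Euler operator `x d/dx` turns a solution of `a h (x ^ s) - z h(x) = b x ^ m` into one
for `a s` and `b m`. -/
theorem euler_comp_pow_sub {s m : ℕ} (hs : s ≠ 0) (hm : m ≠ 0) {h : ℝ → ℂ}
    (hh : AnalyticOnNhd ℝ h Set.univ) {a b z : ℂ}
    (e : ∀ x : ℝ, a * h (x ^ s) - z * h x = b * (x : ℂ) ^ m) (x : ℝ) :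
    a * s * (((x ^ s : ℝ) : ℂ) * deriv h (x ^ s)) - z * (x * deriv h x) =
      b * m * (x : ℂ) ^ m := by
  have hd : ∀ y, HasDerivAt h (deriv h y) y := fun y => (hh y trivial).differentiableAt.hasDerivAt
  have h1 : HasDerivAt (fun x : ℝ => h (x ^ s)) ((s * x ^ (s - 1) : ℝ) • deriv h (x ^ s)) x :=
    (hd (x ^ s)).scomp x (hasDerivAt_pow s x)
  have h2 : HasDerivAt (fun x : ℝ => (x : ℂ) ^ m) (m * (x : ℂ) ^ (m - 1)) x :=
    (hasDerivAt_pow m (x : ℂ)).comp_ofReal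
  have h3 := (h1.const_mul a).sub ((hd x).const_mul z)
  have h4 := h2.const_mul b
  have h5 : a * ((s * x ^ (s - 1) : ℝ) • deriv h (x ^ s)) - z * deriv h x =
      b * (m * (x : ℂ) ^ (m - 1)) := by
    refine h3.unique (h4.congr_of_eventuallyEq (Eventually.of_forall fun y => ?_))
    exact e y
  have es : (x : ℂ) ^ s = x ^ (s - 1) * x := (pow_sub_one_mul hs _).symm
  have em : (x : ℂ) ^ m = x ^ (m - 1) * x := (pow_sub_one_mul hm _).symm
  rw [Complex.real_smul] at h5
  push_cast at h5 ⊢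
  rw [es, em]
  linear_combination (x : ℂ) * h5

/-- Used to make `s ^ (n + 1)` exceed `‖z‖`. At least one Euler operator is applied, which gives `h
0 = 0`. -/
theorem exists_euler_iterate {s m : ℕ} (hs : s ≠ 0) (hm : m ≠ 0) {f : ℝ → ℂ}
    (hf : AnalyticOnNhd ℝ f Set.univ) {z : ℂ}
    (e : ∀ x : ℝ, f (x ^ s) - z * f x = (x : ℂ) ^ m) (n : ℕ) :
    ∃ h : ℝ → ℂ, AnalyticOnNhd ℝ h Set.univ ∧ h 0 = 0 ∧
      ∀ x : ℝ, (s : ℂ) ^ (n + 1) * h (x ^ s) - z * h x = (m : ℂ) ^ (n + 1) * (x : ℂ) ^ m := by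
  have han : ∀ g : ℝ → ℂ, AnalyticOnNhd ℝ g Set.univ →
      AnalyticOnNhd ℝ (fun x : ℝ => (x : ℂ) * deriv g x) Set.univ := fun g hg =>
    AnalyticOnNhd.mul (fun x _ => Complex.ofRealCLM.analyticAt x) hg.deriv
  induction n with
  | zero =>
    refine ⟨fun x => x * deriv f x, han f hf, by simp, fun x => ?_⟩
    have := euler_comp_pow_sub (a := 1) (b := 1) hs hm hf (by simpa using e) x
    simpa using this
  | succ n ih =>
    obtain ⟨h, hh, -, he⟩ := ih
    refine ⟨fun x => x * deriv h x, han h hh, by simp, fun x => ?_⟩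
    rw [pow_succ _ (n + 1), pow_succ _ (n + 1)]
    exact euler_comp_pow_sub hs hm hh he x

/-- With `ν = a / z`, the right-hand side at `x_i` is, up to a constant, the increment of the
summable family `ν ^ i * h (x_i)`. -/
theorem tsum_zpow_mul_exp_pow_eq_zero {s m : ℕ} (hs : 1 < s) {h : ℝ → ℂ}
    (hh : AnalyticOnNhd ℝ h Set.univ) (h0 : h 0 = 0) {a b z : ℂ} (hz : z ≠ 0) (hb : b ≠ 0)
    (hza : ‖z‖ < ‖a‖) (e : ∀ x : ℝ, a * h (x ^ s) - z * h x = b * (x : ℂ) ^ m) :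
    ∑' i : ℤ, (a / z) ^ i * (Real.exp (-(s : ℝ) ^ i) : ℂ) ^ m = 0 := by
  have hν : 1 < ‖a / z‖ := by rwa [norm_div, one_lt_div (norm_pos_iff.2 hz)]
  have hν0 : a / z ≠ 0 := norm_pos_iff.1 (zero_lt_one.trans hν)
  set A : ℤ → ℂ := fun i => (a / z) ^ i * h (Real.exp (-(s : ℝ) ^ i)) with hA
  obtain ⟨C, hC⟩ := hh.exists_norm_le_mul h0
  have hsum : Summable A := by
    refine Summable.of_norm_bounded ((summable_zpow_mul_exp_neg_zpow hs hν).mul_left C)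
      fun i => ?_
    have := hC (Real.exp (-(s : ℝ) ^ i))
      ⟨(Real.exp_pos _).le, Real.exp_le_one_iff.2 (neg_nonpos.2 (by positivity))⟩
    rw [hA, norm_mul, norm_zpow, mul_left_comm]
    gcongr
  have hsum' : Summable fun i => A (i + 1) := (Equiv.addRight (1 : ℤ)).summable_iff.2 hsum
  have hsub : ∑' i, (A (i + 1) - A i) = 0 := by
    rw [hsum'.tsum_sub hsum]
    exact sub_eq_zero.2 ((Equiv.addRight (1 : ℤ)).tsum_eq A)
  have hterm : ∀ i : ℤ, A (i + 1) - A i =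
      b / z * ((a / z) ^ i * (Real.exp (-(s : ℝ) ^ i) : ℂ) ^ m) := by
    intro i
    have hx : Real.exp (-(s : ℝ) ^ (i + 1)) = Real.exp (-(s : ℝ) ^ i) ^ s := by
      rw [← Real.exp_nat_mul, zpow_add_one₀ (by positivity)]
      ring_nf
    simp only [hA]
    rw [hx, zpow_add_one₀ hν0]
    have := e (Real.exp (-(s : ℝ) ^ i))
    generalize (a / z) ^ i = w
    field_simp
    linear_combination w * this
  simp only [hterm] at hsub
  rw [tsum_mul_left] at hsub
  exact (mul_eq_zero.1 hsub).resolve_left (div_ne_zero hb hz)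

/-- The points `exp (-s ^ i)`, `i ∈ ℤ`, are separated by polynomials. -/
theorem exists_tsum_zpow_mul_exp_pow_ne_zero {s : ℕ} (hs : 1 < s) {ν : ℂ} (hν : 1 < ‖ν‖) :
    ∃ m : ℕ, m ≠ 0 ∧ ∑' i : ℤ, ν ^ i * (Real.exp (-(s : ℝ) ^ i) : ℂ) ^ m ≠ 0 := by
  by_contra! H
  set x : ℤ → ℝ := fun i => Real.exp (-(s : ℝ) ^ i) with hx
  have hx0 : ∀ i, 0 < x i := fun i => Real.exp_pos _
  have hx1 : ∀ i, x i ≤ 1 := fun i =>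
    Real.exp_le_one_iff.2 (neg_nonpos.2 (by positivity))
  have hw : Summable fun i : ℤ => ‖ν‖ ^ i * x i := summable_zpow_mul_exp_neg_zpow hs hν
  have hs' : ∀ q : Polynomial ℝ, Summable fun i : ℤ => ν ^ i * x i * (q.eval (x i) : ℝ) := by
    intro q
    obtain ⟨C, hC⟩ := (isCompact_Icc (a := (0 : ℝ)) (b := 1)).exists_bound_of_continuousOn
      q.continuous.continuousOn
    refine Summable.of_norm_bounded (hw.mul_right C) fun i => ?_
    rw [norm_mul, norm_mul, norm_zpow, Complex.norm_real, Complex.norm_real,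
      Real.norm_of_nonneg (hx0 i).le]
    have := hC (x i) ⟨(hx0 i).le, hx1 i⟩
    have := (hx0 i).le
    gcongr
  have hq : ∀ q : Polynomial ℝ, ∑' i : ℤ, ν ^ i * x i * (q.eval (x i) : ℝ) = 0 := by
    intro q
    induction q using Polynomial.induction_on' with
    | add p q hp hq =>
      simp only [Polynomial.eval_add, Complex.ofReal_add, mul_add]
      rw [(hs' p).tsum_add (hs' q), hp, hq, add_zero]
    | monomial n c =>
      -- The factor `x i` in the weight raises the exponent, so `m ≥ 1` suffices.
      have := H (n + 1) n.succ_ne_zero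
      rw [← mul_zero (c : ℂ), ← this, ← tsum_mul_left]
      refine tsum_congr fun i => ?_
      change _ = (c : ℂ) * (ν ^ i * (x i : ℂ) ^ (n + 1))
      simp only [Polynomial.eval_monomial, Complex.ofReal_mul, Complex.ofReal_pow]
      ring
  -- These polynomials peak at `x 0` and tend to `0` at the other orbit points, isolating the term
  -- `i = 0`.
  have hlim : Tendsto (fun N : ℕ => ∑' i : ℤ, ν ^ i * x i *
      ((((1 - (Polynomial.X - Polynomial.C (x 0)) ^ 2) ^ N : Polynomial ℝ).eval (x i) : ℝ) : ℂ))
      atTop (𝓝 (∑' i : ℤ, if i = 0 then (x 0 : ℂ) else 0)) := by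
    refine tendsto_tsum_of_dominated_convergence hw (fun i => ?_)
      (Eventually.of_forall fun N i => ?_)
    · split_ifs with hi
      · subst hi
        simp
      · have hne : x i ≠ x 0 := by
          intro h
          have h1 := neg_injective (Real.exp_injective h)
          exact hi (zpow_right_injective₀ (by positivity) (by exact_mod_cast hs.ne') h1)
        have hpos : 0 < (x i - x 0) ^ 2 := by
          have := sub_ne_zero.2 hne
          positivity
        have hle : (x i - x 0) ^ 2 ≤ 1 := by
          rw [sq_le_one_iff_abs_le_one, abs_le]
          constructor <;> linarith [hx0 i, hx1 i, hx0 0, hx1 0]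
        have := tendsto_pow_atTop_nhds_zero_of_lt_one (r := 1 - (x i - x 0) ^ 2)
          (by linarith) (by linarith)
        have h2 := ((Complex.continuous_ofReal.tendsto _).comp this).const_mul (ν ^ i * x i)
        rw [Complex.ofReal_zero, mul_zero] at h2
        refine h2.congr fun N => ?_
        simp
    · have hle : (x i - x 0) ^ 2 ≤ 1 := by
        rw [sq_le_one_iff_abs_le_one, abs_le]
        constructor <;> linarith [hx0 i, hx1 i, hx0 0, hx1 0]
      have h1 : |1 - (x i - x 0) ^ 2| ≤ 1 := by
        rw [abs_le]
        constructor <;> linarith [sq_nonneg (x i - x 0)]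
      rw [norm_mul, norm_mul, norm_zpow, Complex.norm_real, Complex.norm_real,
        Real.norm_of_nonneg (hx0 i).le]
      have := hx0 i
      refine mul_le_of_le_one_right (by positivity) ?_
      simpa using pow_le_one₀ (abs_nonneg _) h1
  simp only [hq, tsum_ite_eq] at hlim
  have := tendsto_nhds_unique hlim tendsto_const_nhds
  exact (hx0 0).ne' (by exact_mod_cast this)

/-- Some monomial `x ^ m` is not of the form `f (x ^ s) - z f(x)` with `f` real analytic. -/
theorem exists_pow_ne_comp_pow_sub_mul {s : ℕ} (hs : 1 < s) (z : ℂ) :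
    ∃ m : ℕ, ∀ f : ℝ → ℂ, AnalyticOnNhd ℝ f Set.univ →
      ¬ ∀ x : ℝ, f (x ^ s) - z * f x = (x : ℂ) ^ m := by
  rcases eq_or_ne z 0 with rfl | hz
  -- For `z = 0`, the derivative of `f (x ^ s)` at `0` vanishes since `s > 1`, but that of `x` is
  -- `1`.
  · refine ⟨1, fun f hf e => ?_⟩
    have h1 : HasDerivAt (fun x : ℝ => f (x ^ s))
        ((s * (0 : ℝ) ^ (s - 1) : ℝ) • deriv f (0 ^ s)) 0 :=
      ((hf _ trivial).differentiableAt.hasDerivAt).scomp (0 : ℝ) (hasDerivAt_pow s (0 : ℝ))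
    have h2 : HasDerivAt (fun x : ℝ => f (x ^ s)) 1 0 := by
      refine (Complex.ofRealCLM.hasDerivAt (x := (0 : ℝ))).congr_of_eventuallyEq
        (Eventually.of_forall fun x => ?_) |>.congr_deriv (by simp)
      simpa using e x
    have h3 := h1.unique h2
    simp [zero_pow (by omega : s - 1 ≠ 0)] at h3
  · obtain ⟨n, hn⟩ := pow_unbounded_of_one_lt ‖z‖ (show (1 : ℝ) < s by exact_mod_cast hs)
    have hza : ‖z‖ < ‖(s : ℂ) ^ (n + 1)‖ := by
      rw [norm_pow, Complex.norm_natCast]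
      exact hn.trans_le (pow_le_pow_right₀ (by exact_mod_cast hs.le) n.le_succ)
    obtain ⟨m, hm, hne⟩ := exists_tsum_zpow_mul_exp_pow_ne_zero hs (ν := (s : ℂ) ^ (n + 1) / z)
      (by rwa [norm_div, one_lt_div (norm_pos_iff.2 hz)])
    refine ⟨m, fun f hf e => hne ?_⟩
    obtain ⟨h, hh, h0, he⟩ := exists_euler_iterate (by omega) hm hf e n
    exact tsum_zpow_mul_exp_pow_eq_zero hs hh h0 hz
      (pow_ne_zero _ (by exact_mod_cast hm)) hza he

theorem mainTheorem11 (δ : ℝ ≃ ℝ) (hδ : AnalyticOnNhd ℝ δ Set.univ)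
    (hδ_symm : AnalyticOnNhd ℝ δ.symm Set.univ) (s : ℕ) (hs : 1 < s) :
    ∃ hφ : AnalyticOnNhd ℝ (fun x : ℝ => δ.symm (δ x ^ s)) Set.univ,
      {z : ℂ | (compositionOperator (fun x : ℝ => δ.symm (δ x ^ s)) hφ).HasEigenvalue z} = {1} ∧
      spectrum ℂ (compositionOperator (fun x : ℝ => δ.symm (δ x ^ s)) hφ) = Set.univ := by
  have hφ : AnalyticOnNhd ℝ (fun x : ℝ => δ.symm (δ x ^ s)) Set.univ :=
    AnalyticOnNhd.comp hδ_symm (hδ.pow s) (Set.mapsTo_univ _ _)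
  have hconj : ∀ f : RealAnalyticSpace,
      AnalyticOnNhd ℝ (fun x => (f : ℝ → ℂ) (δ.symm x)) Set.univ := fun f =>
    AnalyticOnNhd.comp f.2 hδ_symm (Set.mapsTo_univ _ _)
  refine ⟨hφ, ?_, ?_⟩
  · ext z
    simp only [Set.mem_ofPred_eq, Set.mem_singleton_iff]
    constructor
    · intro hz
      obtain ⟨f, hf⟩ := hz.exists_hasEigenvector
      have hfe : ∀ x, (f : ℝ → ℂ) (δ.symm (δ x ^ s)) = z * (f : ℝ → ℂ) x := fun x =>
        congrFun (congrArg Subtype.val hf.apply_eq_smul) x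
      by_contra hz1
      refine hf.2 ?_
      have he : ∀ y, (f : ℝ → ℂ) (δ.symm (y ^ s)) = z * (f : ℝ → ℂ) (δ.symm y) := fun y => by
        simpa using hfe (δ.symm y)
      have h0 : (f : ℝ → ℂ) (δ.symm 0) = 0 := by
        have h := he 0
        rw [zero_pow (by omega)] at h
        have : (1 - z) * (f : ℝ → ℂ) (δ.symm 0) = 0 := by linear_combination h
        exact (mul_eq_zero.1 this).resolve_left (sub_ne_zero.2 (Ne.symm hz1))
      have := eq_zero_of_comp_pow_eq_mul hs (hconj f) h0 he
      ext x
      simpa using congrFun this (δ x)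
    · rintro rfl
      refine Module.End.hasEigenvalue_of_hasEigenvector
        (x := (⟨fun _ => 1, analyticOnNhd_const⟩ : RealAnalyticSpace)) ⟨?_, ?_⟩
      · rw [Module.End.mem_eigenspace_iff, one_smul]
        rfl
      · intro h
        exact one_ne_zero (congrFun (congrArg Subtype.val h) 0)
  · refine Set.eq_univ_of_forall fun z => ?_
    rw [spectrum.mem_iff, Module.End.isUnit_iff]
    intro hbij
    obtain ⟨m, hm⟩ := exists_pow_ne_comp_pow_sub_mul hs z
    -- The minus sign is there because `spectrum` uses `z - C_φ`.
    have hg : AnalyticOnNhd ℝ (fun x : ℝ => -(δ x : ℂ) ^ m) Set.univ :=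
      ((AnalyticOnNhd.comp (fun x _ => Complex.ofRealCLM.analyticAt x) hδ
        (Set.mapsTo_univ _ Set.univ)).pow m).neg
    obtain ⟨f, hf⟩ := hbij.2 ⟨_, hg⟩
    refine hm _ (hconj f) fun y => ?_
    have := congrFun (congrArg Subtype.val hf) (δ.symm y)
    have h2 : z * (f : ℝ → ℂ) (δ.symm y) - (f : ℝ → ℂ) (δ.symm (δ (δ.symm y) ^ s)) =
      -(δ (δ.symm y) : ℂ) ^ m := this
    rw [δ.apply_symm_apply] at h2
    linear_combination -h2
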